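/- For $N\in\mathbb{N}$ and $W\in(0,\tfrac12)$ let $\mathbf{B}_{N,W}$ be the $N\times N$ prolate matrix with entries $\mathbf{B}_{N,W}[m,n]=\frac{\sin(2\pi W(m-n))}{\pi(m-n)}$ for $m\neq n$ and $\mathbf{B}_{N,W}[n,n]=2W$, $m,n\in\{0,\dots,N-1\}$. The discrete prolate spheroidal sequence (DPSS) vectors $\mathbf{s}_0,\dots,\mathbf{s}_{N-1}\in\mathbb{C}^N$ are an orthonormal basis of eigenvectors of $\mathbf{B}_{N,W}$, ordered so that the corresponding eigenvalues are nonincreasing. For $K\le N$ let $[\mathbf{S}]_K=[\mathbf{s}_0\ \cdots\ \mathbf{s}_{K-1}]$ be the $N\times K$ matrix of the first $K$ DPSS vectors, and for $f\in\mathbb{R}$ let $\mathbf{e}_f=(e^{2\pi i f n})_{n=0}^{N-1}\in\mathbb{C}^N$. Theorem. There is an absolute constant $C>0$ such that for every integer $N\ge 2$, every $W\in(0,\tfrac12)$ and every $\epsilon\in(0,\tfrac12)$ there is an integer $0\le K\le N$ with $$|K-2NW|\le C\,\log(N)\,\log\!\left(\tfrac{1}{\epsilon^2}\right),$$ i.e.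 $K=2NW+O\!\left(\log(N)\log(1/\epsilon^2)\right)$, such that for every choice of the DPSS vectors $$\frac{\left\|\mathbf{e}_f-[\mathbf{S}]_K[\mathbf{S}]_K^*\mathbf{e}_f\right\|_2^2}{\|\mathbf{e}_f\|_2^2}\le\epsilon\qquad\text{for all } f\in[-W,W].$$ -/

import Mathlib

open scoped Matrix

noncomputable section

/-- The `N × N` prolate matrix, with entries `sin (2πW(m - n)) / (π(m - n))`
off the diagonal and the limiting value `2W` on the diagonal. -/
def prolateMatrix (N : ℕ) (W : ℝ) : Matrix (Fin N) (Fin N) ℂ :=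
  Matrix.of fun m n =>
    if m = n then ((2 * W : ℝ) : ℂ)
    else ((Real.sin (2 * Real.pi * W * ((m : ℝ) - (n : ℝ))) /
      (Real.pi * ((m : ℝ) - (n : ℝ))) : ℝ) : ℂ)

/-- `s 0, …, s (N - 1)` is a system of DPSS vectors: an orthonormal family of eigenvectors of the
prolate matrix, listed in order of nonincreasing eigenvalue. -/
def IsDPSS (N : ℕ) (W : ℝ) (s : Fin N → EuclideanSpace ℂ (Fin N)) : Prop :=
  Orthonormal ℂ s ∧
    ∃ ν : Fin N → ℝ, Antitone ν ∧
      ∀ l : Fin N, prolateMatrix N W *ᵥ (s l).ofLp = (ν l : ℂ) • (s l).ofLp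

/-- The `N × K` matrix whose columns are the first `K` vectors of the family `s`. -/
def firstColumns {N K : ℕ} (hK : K ≤ N) (s : Fin N → EuclideanSpace ℂ (Fin N)) :
    Matrix (Fin N) (Fin K) ℂ :=
  Matrix.of fun n k => s (Fin.castLE hK k) n

/-- The sampled complex exponential `n ↦ exp (2πifn)`, `n = 0, …, N - 1`. -/
def sampledExp (N : ℕ) (f : ℝ) : Fin N → ℂ :=
  fun n => Complex.exp (2 * Real.pi * Complex.I * f * (n : ℂ))

/-- The Euclidean norm on `ℂ^N`. -/
def l2norm {N : ℕ} (x : Fin N → ℂ) : ℝ := ‖(WithLp.toLp 2 x : EuclideanSpace ℂ (Fin N))‖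

end

open Finset Module Polynomial
open scoped FourierTransform ComplexConjugate

/-!
The quadratic form of the prolate matrix is the band energy `∫_{-W}^{W} |x̂(f)|² df` of the
discrete-time Fourier transform, so by min-max an eigenvalue of index `k` is small as soon as a
subspace of codimension at most `k` consists of vectors of small relative band energy.

Put `δ = 1/N` and `V = W + δ`. The subspace is that of the polynomials `p = A₊ B g` of degree less
than `N`, where `B` vanishes at the points of the grid `N⁻¹ℤ` in the band `(-V, V)` and `A₊` is the
`m`-th power of a product of linear factors with dyadic parameters `δ 2^j`, `j < J`. Compare `p`
with `q = A₋ B g`, in which the sign of the parameters is changed. Outside `(-V, V)` one has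
`|A₋| ≤ |A₊|`, hence `‖q‖ ≤ ‖p‖` by Parseval on the grid. On `[-W, W]` one dyadic factor, the one
matching the scale of `f`, gains `1/3`, so `|A₊| ≤ 3^{-m} |A₋|`. Thus the relative band energy of
`p` is at most `9^{-m} min(1, 2NW)`, with `m ~ log (1/ε²)` and `J ~ log N` leaving codimension
`2NW + O(log N log (1/ε²))`.

The residual `x` of `e_f` is a combination of the remaining eigenvectors and satisfies
`x̂(f) = ‖x‖²`. As `x̂` is Lipschitz, `‖x‖² > εN` would force a larger band energy than the
eigenvalues allow.
-/

section Eigenvectors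

variable {𝕜 E ι : Type*} [RCLike 𝕜] [NormedAddCommGroup E] [InnerProductSpace 𝕜 E]
  {s : ι → E} {T : E →ₗ[𝕜] E} {ν : ι → ℝ}

theorem norm_sq_sum_smul_of_orthonormal (hs : Orthonormal 𝕜 s) (c : ι → 𝕜) (S : Finset ι) :
    ‖∑ l ∈ S, c l • s l‖ ^ 2 = ∑ l ∈ S, ‖c l‖ ^ 2 := by
  have h : ((‖∑ l ∈ S, c l • s l‖ ^ 2 : ℝ) : 𝕜) = ((∑ l ∈ S, ‖c l‖ ^ 2 : ℝ) : 𝕜) := by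
    push_cast
    rw [← inner_self_eq_norm_sq_to_K, hs.inner_sum]
    simp only [RCLike.conj_mul]
  exact_mod_cast h

theorem inner_sum_inner_smul_of_orthonormal (hs : Orthonormal 𝕜 s) (e : E) (S : Finset ι) :
    inner 𝕜 e (∑ l ∈ S, inner 𝕜 (s l) e • s l) = (‖∑ l ∈ S, inner 𝕜 (s l) e • s l‖ ^ 2 : ℝ) := by
  rw [norm_sq_sum_smul_of_orthonormal hs, inner_sum, RCLike.ofReal_sum]
  refine sum_congr rfl fun l _ => ?_
  rw [inner_smul_right, ← inner_conj_symm, RCLike.conj_mul, RCLike.norm_conj, RCLike.ofReal_pow]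

theorem re_inner_map_sum_smul_of_eigenvectors (hs : Orthonormal 𝕜 s)
    (hT : ∀ l, T (s l) = (ν l : 𝕜) • s l) (c : ι → 𝕜) (S : Finset ι) :
    RCLike.re (inner 𝕜 (∑ l ∈ S, c l • s l) (T (∑ l ∈ S, c l • s l))) =
      ∑ l ∈ S, ν l * ‖c l‖ ^ 2 := by
  have hTsum : T (∑ l ∈ S, c l • s l) = ∑ l ∈ S, ((ν l : 𝕜) * c l) • s l := by
    simp only [map_sum, map_smul, hT, smul_smul, mul_comm]
  rw [hTsum, hs.inner_sum, map_sum]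
  refine sum_congr rfl fun l _ => ?_
  rw [mul_left_comm, RCLike.conj_mul, RCLike.re_ofReal_mul]
  norm_cast

theorem re_inner_map_sum_smul_le_of_eigenvalue_le (hs : Orthonormal 𝕜 s)
    (hT : ∀ l, T (s l) = (ν l : 𝕜) • s l) (c : ι → 𝕜) {S : Finset ι} {γ : ℝ}
    (hγ : ∀ l ∈ S, ν l ≤ γ) :
    RCLike.re (inner 𝕜 (∑ l ∈ S, c l • s l) (T (∑ l ∈ S, c l • s l))) ≤
      γ * ‖∑ l ∈ S, c l • s l‖ ^ 2 := by
  rw [re_inner_map_sum_smul_of_eigenvectors hs hT, norm_sq_sum_smul_of_orthonormal hs, mul_sum]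
  gcongr with l hl
  exact hγ l hl

theorem exists_sum_smul_mem_ne_zero_of_finrank_lt [FiniteDimensional 𝕜 E]
    (hs : LinearIndependent 𝕜 s) (S : Finset ι) {U : Submodule 𝕜 E}
    (hU : finrank 𝕜 E < finrank 𝕜 U + #S) :
    ∃ c : ι → 𝕜, ∑ l ∈ S, c l • s l ∈ U ∧ ∑ l ∈ S, c l • s l ≠ 0 := by
  have hspan : finrank 𝕜 (Submodule.span 𝕜 (s '' S)) = #S := by
    rw [Set.image_eq_range, ← Fintype.card_coe]
    exact finrank_span_eq_card (hs.comp ((↑) : S → ι) Subtype.val_injective)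
  obtain ⟨x, ⟨hxU, hxS⟩, hx⟩ : ∃ x ∈ U ⊓ Submodule.span 𝕜 (s '' S), x ≠ 0 := by
    refine Submodule.exists_mem_ne_zero_of_ne_bot fun hbot => ?_
    have := Submodule.finrank_add_finrank_le_of_disjoint (disjoint_iff.2 hbot)
    omega
  obtain ⟨c, rfl⟩ := (Submodule.mem_span_image_finset_iff_exists_fun' 𝕜).1 hxS
  exact ⟨c, hxU, hx⟩

theorem eigenvalue_le_of_finrank_le [FiniteDimensional 𝕜 E] {n : ℕ} {s : Fin n → E}
    {ν : Fin n → ℝ} (hs : Orthonormal 𝕜 s) (hν : Antitone ν)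
    (hT : ∀ l, T (s l) = (ν l : 𝕜) • s l) {U : Submodule 𝕜 E} {γ : ℝ}
    (hU : ∀ x ∈ U, RCLike.re (inner 𝕜 x (T x)) ≤ γ * ‖x‖ ^ 2) {k : Fin n}
    (hk : finrank 𝕜 E ≤ finrank 𝕜 U + k) : ν k ≤ γ := by
  have hcard : finrank 𝕜 E < finrank 𝕜 U + #(Iic k) := by rw [Fin.card_Iic]; omega
  obtain ⟨c, hcU, hc⟩ :=
    exists_sum_smul_mem_ne_zero_of_finrank_lt hs.linearIndependent (Iic k) hcard
  set x := ∑ l ∈ Iic k, c l • s l with hx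
  have hlow : ν k * ‖x‖ ^ 2 ≤ RCLike.re (inner 𝕜 x (T x)) := by
    rw [hx, re_inner_map_sum_smul_of_eigenvectors hs hT, norm_sq_sum_smul_of_orthonormal hs,
      mul_sum]
    gcongr with l hl
    exact hν (mem_Iic.1 hl)
  exact le_of_mul_le_mul_right (hlow.trans (hU x hcU)) (by positivity)

end Eigenvectors

section Fourier

theorem coe_fourierChar_neg (f : ℝ) : (𝐞 (-f) : ℂ) = conj (𝐞 f : ℂ) := by
  rw [AddChar.map_neg_eq_inv, Circle.coe_inv_eq_conj]

theorem norm_fourierChar_sub_le (a b : ℝ) : ‖(𝐞 a : ℂ) - 𝐞 b‖ ≤ 2 * Real.pi * |a - b| := by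
  have hfactor : (𝐞 a : ℂ) - 𝐞 b =
      𝐞 b * (Complex.exp (Complex.I * (2 * Real.pi * (a - b) : ℝ)) - 1) := by
    rw [mul_sub, mul_one, Real.fourierChar_apply, Real.fourierChar_apply, ← Complex.exp_add]
    push_cast; ring_nf
  calc ‖(𝐞 a : ℂ) - 𝐞 b‖
      = ‖Complex.exp (Complex.I * (2 * Real.pi * (a - b) : ℝ)) - 1‖ := by
        rw [hfactor, norm_mul, Circle.norm_coe, one_mul]
    _ ≤ ‖2 * Real.pi * (a - b)‖ := Real.norm_exp_I_mul_ofReal_sub_one_le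
    _ = 2 * Real.pi * |a - b| := by
        rw [norm_mul, Real.norm_of_nonneg Real.two_pi_pos.le, Real.norm_eq_abs]

theorem integral_fourierChar_mul {a : ℝ} (ha : a ≠ 0) (W : ℝ) :
    ∫ f in (-W)..W, (𝐞 (a * f) : ℂ) =
      ((Real.sin (2 * Real.pi * W * a) / (Real.pi * a) : ℝ) : ℂ) := by
  have hc : (2 * Real.pi * a * Complex.I : ℂ) ≠ 0 := by
    simp [ha, Real.pi_ne_zero]
  have hexp (f : ℝ) : (𝐞 (a * f) : ℂ) = Complex.exp (2 * Real.pi * a * Complex.I * f) := by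
    rw [Real.fourierChar_apply]; push_cast; ring_nf
  simp only [hexp]
  rw [integral_exp_mul_complex hc]
  have hsin : Complex.exp (2 * Real.pi * a * Complex.I * W) -
      Complex.exp (2 * Real.pi * a * Complex.I * (-W : ℝ)) =
        2 * Complex.I * Complex.sin (2 * Real.pi * W * a) := by
    rw [Complex.sin]
    ring_nf
    simp only [Complex.I_sq]
    push_cast
    ring_nf
  rw [hsin]
  push_cast
  field_simp

/-- The sampled exponential `sampledExp N f` as a vector of the Hilbert space `ℂ ^ N`. -/
noncomputable def expVec (N : ℕ) (f : ℝ) : EuclideanSpace ℂ (Fin N) :=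
  WithLp.toLp 2 (sampledExp N f)

/-- The discrete-time Fourier transform `∑ n, x n * exp (-2πifn)`, encoded as an inner product. -/
noncomputable def dtft {N : ℕ} (x : EuclideanSpace ℂ (Fin N)) (f : ℝ) : ℂ :=
  inner ℂ (expVec N f) x

/-- The energy of the spectrum of `x` in the frequency band `[-W, W]`. -/
noncomputable def bandEnergy {N : ℕ} (W : ℝ) (x : EuclideanSpace ℂ (Fin N)) : ℝ :=
  ∫ f in (-W)..W, ‖dtft x f‖ ^ 2

variable {N : ℕ}

theorem sampledExp_apply (f : ℝ) (n : Fin N) : sampledExp N f n = 𝐞 (n * f) := by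
  rw [sampledExp, Real.fourierChar_apply]
  push_cast; ring_nf

theorem norm_sampledExp (f : ℝ) (n : Fin N) : ‖sampledExp N f n‖ = 1 := by
  rw [sampledExp_apply, Circle.norm_coe]

theorem sampledExp_mul_conj (f : ℝ) (m n : Fin N) :
    sampledExp N f m * conj (sampledExp N f n) = (𝐞 (((m : ℝ) - n) * f) : ℂ) := by
  rw [sampledExp_apply, sampledExp_apply, ← coe_fourierChar_neg, ← Circle.coe_mul,
    ← AddChar.map_add_eq_mul, sub_mul, sub_eq_add_neg]

theorem norm_expVec_sq (f : ℝ) : ‖expVec N f‖ ^ 2 = N := by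
  simp [expVec, EuclideanSpace.norm_sq_eq, norm_sampledExp]

theorem continuous_expVec : Continuous (expVec N) := by
  unfold expVec sampledExp; fun_prop

theorem norm_expVec_sub_le (f f' : ℝ) :
    ‖expVec N f - expVec N f'‖ ≤ √N * (2 * Real.pi * N * |f - f'|) := by
  have hcoord (n : Fin N) :
      ‖sampledExp N f n - sampledExp N f' n‖ ≤ 2 * Real.pi * N * |f - f'| := by
    calc ‖sampledExp N f n - sampledExp N f' n‖ ≤ 2 * Real.pi * |n * f - n * f'| := by
          simpa only [sampledExp_apply] using norm_fourierChar_sub_le _ _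
      _ = 2 * Real.pi * n * |f - f'| := by rw [← mul_sub, abs_mul, Nat.abs_cast, ← mul_assoc]
      _ ≤ 2 * Real.pi * N * |f - f'| := by gcongr; exact n.2.le
  rw [EuclideanSpace.norm_eq, ← Real.sqrt_sq (show 0 ≤ 2 * Real.pi * N * |f - f'| by positivity),
    ← Real.sqrt_mul N.cast_nonneg]
  refine Real.sqrt_le_sqrt ?_
  calc ∑ n, ‖(expVec N f - expVec N f') n‖ ^ 2
      ≤ ∑ _ : Fin N, (2 * Real.pi * N * |f - f'|) ^ 2 := by gcongr with n; exact hcoord n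
    _ = N * (2 * Real.pi * N * |f - f'|) ^ 2 := by simp

theorem continuous_dtft (x : EuclideanSpace ℂ (Fin N)) : Continuous (dtft x) :=
  continuous_expVec.inner continuous_const

theorem intervalIntegrable_norm_sq_dtft (x : EuclideanSpace ℂ (Fin N)) (a b : ℝ) :
    IntervalIntegrable (fun f => ‖dtft x f‖ ^ 2) MeasureTheory.volume a b :=
  ((continuous_dtft x).norm.pow 2).intervalIntegrable a b

theorem norm_dtft_sq_le (x : EuclideanSpace ℂ (Fin N)) (f : ℝ) :
    ‖dtft x f‖ ^ 2 ≤ N * ‖x‖ ^ 2 := by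
  rw [← norm_expVec_sq f, ← mul_pow]
  exact pow_le_pow_left₀ (norm_nonneg _) (norm_inner_le_norm _ _) 2

theorem norm_dtft_sub_le (x : EuclideanSpace ℂ (Fin N)) (f f' : ℝ) :
    ‖dtft x f - dtft x f'‖ ≤ √N * (2 * Real.pi * N * |f - f'|) * ‖x‖ := by
  rw [dtft, dtft, ← inner_sub_left]
  exact (norm_inner_le_norm _ _).trans (by gcongr; exact norm_expVec_sub_le f f')

theorem dtft_eq_sum (x : EuclideanSpace ℂ (Fin N)) (f : ℝ) :
    dtft x f = ∑ n, conj (sampledExp N f n) * x n := by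
  simp [dtft, expVec, PiLp.inner_apply, mul_comm]

theorem norm_dtft_sq_eq_sum (x : EuclideanSpace ℂ (Fin N)) (f : ℝ) :
    ((‖dtft x f‖ ^ 2 : ℝ) : ℂ) =
      ∑ m : Fin N, ∑ n : Fin N, conj (x m) * (𝐞 (((m : ℝ) - n) * f) : ℂ) * x n := by
  push_cast
  rw [← Complex.conj_mul', dtft_eq_sum, map_sum, sum_mul_sum]
  refine sum_congr rfl fun m _ => sum_congr rfl fun n _ => ?_
  rw [← sampledExp_mul_conj, map_mul, Complex.conj_conj]
  ring

theorem integral_fourierChar_sub_mul_eq_prolateMatrix (W : ℝ) (m n : Fin N) :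
    ∫ f in (-W)..W, (𝐞 (((m : ℝ) - n) * f) : ℂ) = prolateMatrix N W m n := by
  obtain rfl | hmn := eq_or_ne m n
  · simp [prolateMatrix, two_mul]
  · have hsub : (m : ℝ) - n ≠ 0 := sub_ne_zero.2 (by exact_mod_cast Fin.val_ne_of_ne hmn)
    rw [integral_fourierChar_mul hsub, prolateMatrix, Matrix.of_apply, if_neg hmn]

theorem ofReal_bandEnergy (W : ℝ) (x : EuclideanSpace ℂ (Fin N)) :
    (bandEnergy W x : ℂ) = inner ℂ x ((prolateMatrix N W).toEuclideanLin x) := by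
  have hcont (m n : Fin N) :
      Continuous fun f : ℝ => conj (x m) * (𝐞 (((m : ℝ) - n) * f) : ℂ) * x n := by fun_prop
  rw [bandEnergy, ← intervalIntegral.integral_ofReal]
  simp only [norm_dtft_sq_eq_sum]
  rw [intervalIntegral.integral_finsetSum fun m _ =>
    (continuous_finsetSum _ fun n _ => hcont m n).intervalIntegrable _ _]
  simp only [PiLp.inner_apply, Matrix.ofLp_toLpLin, Matrix.toLin'_apply, Matrix.mulVec,
    dotProduct, RCLike.inner_apply', mul_sum]
  refine sum_congr rfl fun m _ => ?_
  rw [intervalIntegral.integral_finsetSum fun n _ => (hcont m n).intervalIntegrable _ _]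
  refine sum_congr rfl fun n _ => ?_
  rw [intervalIntegral.integral_mul_const, intervalIntegral.integral_const_mul,
    integral_fourierChar_sub_mul_eq_prolateMatrix, mul_assoc]

theorem prolateMatrix_one_half : prolateMatrix N (1 / 2) = 1 := by
  ext m n
  obtain rfl | hmn := eq_or_ne m n
  · simp [prolateMatrix]
  · have hsin : Real.sin (2 * Real.pi * (1 / 2) * ((m : ℝ) - n)) = 0 := by
      rw [← Real.sin_int_mul_pi (m - n)]; push_cast; ring_nf
    rw [prolateMatrix, Matrix.of_apply, if_neg hmn, hsin, zero_div, Complex.ofReal_zero,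
      Matrix.one_apply_ne hmn]

theorem bandEnergy_one_half (x : EuclideanSpace ℂ (Fin N)) :
    bandEnergy (1 / 2) x = ‖x‖ ^ 2 := by
  have h := ofReal_bandEnergy (1 / 2) x
  rw [prolateMatrix_one_half, Matrix.toLpLin_apply, Matrix.one_mulVec, WithLp.toLp_ofLp,
    inner_self_eq_norm_sq_to_K] at h
  exact Complex.ofReal_injective (h.trans (Complex.ofReal_pow _ _).symm)

theorem bandEnergy_le_min {W : ℝ} (hW₀ : 0 ≤ W) (hW : W ≤ 1 / 2)
    (x : EuclideanSpace ℂ (Fin N)) :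
    bandEnergy W x ≤ min 1 (2 * N * W) * ‖x‖ ^ 2 := by
  rw [min_mul_of_nonneg _ _ (sq_nonneg _), one_mul]
  refine le_min ?_ ?_
  · rw [← bandEnergy_one_half]
    exact intervalIntegral.integral_mono_interval (by linarith) (by linarith) hW
      (.of_forall fun f => by positivity) (intervalIntegrable_norm_sq_dtft x _ _)
  · calc bandEnergy W x ≤ ∫ _ in (-W)..W, N * ‖x‖ ^ 2 :=
          intervalIntegral.integral_mono_on (by linarith) (intervalIntegrable_norm_sq_dtft x _ _)
            intervalIntegrable_const fun f _ => norm_dtft_sq_le x f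
      _ = 2 * N * W * ‖x‖ ^ 2 := by
          rw [intervalIntegral.integral_const, smul_eq_mul]; ring

end Fourier

section CoefficientVectors

variable {N : ℕ}

theorem fourierChar_eq_one_iff {a : ℝ} : 𝐞 a = 1 ↔ ∃ k : ℤ, a = k := by
  rw [Circle.ext_iff, Real.fourierChar_apply, Circle.coe_one, Complex.exp_eq_one_iff]
  refine exists_congr fun k => ?_
  rw [show ((2 * Real.pi * a : ℝ) * Complex.I : ℂ) = a * (2 * Real.pi * Complex.I) by
    push_cast; ring, mul_left_inj' Complex.two_pi_I_ne_zero]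
  norm_cast

theorem sum_fourierChar_mul_div_eq_zero [NeZero N] {d : ℤ} (hd : ¬ (N : ℤ) ∣ d) :
    ∑ k ∈ range N, (𝐞 (d * (k / N)) : ℂ) = 0 := by
  have hN : (N : ℝ) ≠ 0 := NeZero.ne _
  have hpow (k : ℕ) : (𝐞 (d * (k / N)) : ℂ) = (𝐞 (d / N) : ℂ) ^ k := by
    rw [← Circle.coe_pow, ← AddChar.map_nsmul_eq_pow, nsmul_eq_mul]
    ring_nf
  have hroot : (𝐞 (d / N) : ℂ) ^ N = 1 := by
    rw [← hpow, div_self hN, mul_one, fourierChar_eq_one_iff.2 ⟨d, rfl⟩, Circle.coe_one]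
  have hne : (𝐞 (d / N) : ℂ) ≠ 1 := by
    rw [Ne, Circle.coe_eq_one, fourierChar_eq_one_iff]
    rintro ⟨k, hk⟩
    rw [div_eq_iff hN] at hk
    exact hd ⟨k, by rw [mul_comm]; exact_mod_cast hk⟩
  simp only [hpow]
  rw [geom_sum_eq hne, hroot, sub_self, zero_div]

theorem sum_fourierChar_sub_mul_div [NeZero N] (m n : Fin N) :
    ∑ k ∈ range N, (𝐞 (((m : ℝ) - n) * (k / N)) : ℂ) = if m = n then (N : ℂ) else 0 := by
  split_ifs with hmn
  · simp [hmn]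
  · have hdvd : ¬ (N : ℤ) ∣ m - n := by
      rw [← Int.modEq_iff_dvd, Int.natCast_modEq_iff]
      exact fun h => hmn (Fin.ext (h.eq_of_lt_of_lt n.2 m.2).symm)
    simpa using sum_fourierChar_mul_div_eq_zero hdvd

theorem sum_norm_dtft_sq_grid [NeZero N] (x : EuclideanSpace ℂ (Fin N)) :
    ∑ k ∈ range N, ‖dtft x (k / N)‖ ^ 2 = N * ‖x‖ ^ 2 := by
  have h : ∑ k ∈ range N, ((‖dtft x (k / N)‖ ^ 2 : ℝ) : ℂ) = N * ‖x‖ ^ 2 := by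
    simp only [norm_dtft_sq_eq_sum]
    rw [sum_comm]
    simp_rw [sum_comm (s := range N), ← sum_mul, ← mul_sum, sum_fourierChar_sub_mul_div]
    simp only [mul_ite, ite_mul, mul_zero, zero_mul, sum_ite_eq, mem_univ, if_true]
    rw [← Complex.ofReal_pow, EuclideanSpace.norm_sq_eq, Complex.ofReal_sum, mul_sum]
    refine sum_congr rfl fun n _ => ?_
    rw [mul_right_comm, Complex.conj_mul', mul_comm, Complex.ofReal_pow]
  exact_mod_cast h

/-- The vector of the first `N` coefficients of a polynomial. It identifies the polynomials of
degree less than `N` with `ℂ ^ N`. -/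
noncomputable def coeffVec (N : ℕ) : ℂ[X] →ₗ[ℂ] EuclideanSpace ℂ (Fin N) :=
  (WithLp.linearEquiv 2 ℂ (Fin N → ℂ)).symm ∘ₗ LinearMap.pi fun n : Fin N => lcoeff ℂ n

theorem coeffVec_apply (p : ℂ[X]) (n : Fin N) : coeffVec N p n = p.coeff n := rfl

theorem dtft_coeffVec {p : ℂ[X]} (hp : p.degree < N) (f : ℝ) :
    dtft (coeffVec N p) f = p.eval (𝐞 (-f) : ℂ) := by
  rw [dtft_eq_sum, eval_eq_sum_degreeLTEquiv (mem_degreeLT.2 hp)]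
  refine sum_congr rfl fun n _ => ?_
  rw [sampledExp_apply, ← coe_fourierChar_neg, mul_comm, ← mul_neg, ← nsmul_eq_mul,
    AddChar.map_nsmul_eq_pow, Circle.coe_pow]
  rfl

theorem norm_coeffVec_le_of_norm_eval_le [NeZero N] {p q : ℂ[X]} (hp : p.degree < N)
    (hq : q.degree < N)
    (h : ∀ k ∈ range N, ‖q.eval (𝐞 (-(k / N)) : ℂ)‖ ≤ ‖p.eval (𝐞 (-(k / N)) : ℂ)‖) :
    ‖coeffVec N q‖ ≤ ‖coeffVec N p‖ := by
  have hN : (0 : ℝ) < N := Nat.cast_pos.2 (NeZero.pos N)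
  rw [← sq_le_sq₀ (norm_nonneg _) (norm_nonneg _), ← mul_le_mul_iff_right₀ hN,
    ← sum_norm_dtft_sq_grid, ← sum_norm_dtft_sq_grid]
  gcongr with k hk
  simpa only [dtft_coeffVec hp, dtft_coeffVec hq] using h k hk

theorem bandEnergy_coeffVec_le_of_norm_eval_le {p q : ℂ[X]} (hp : p.degree < N)
    (hq : q.degree < N) {W c : ℝ} (hW : 0 ≤ W)
    (h : ∀ f ∈ Set.Icc (-W) W, ‖p.eval (𝐞 (-f) : ℂ)‖ ≤ c * ‖q.eval (𝐞 (-f) : ℂ)‖) :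
    bandEnergy W (coeffVec N p) ≤ c ^ 2 * bandEnergy W (coeffVec N q) := by
  rw [bandEnergy, bandEnergy, ← intervalIntegral.integral_const_mul]
  refine intervalIntegral.integral_mono_on (by linarith) (intervalIntegrable_norm_sq_dtft _ _ _)
    ((intervalIntegrable_norm_sq_dtft _ _ _).const_mul _) fun f hf => ?_
  rw [dtft_coeffVec hp, dtft_coeffVec hq, ← mul_pow]
  exact pow_le_pow_left₀ (norm_nonneg _) (h f hf) 2

theorem eq_zero_of_coeffVec_eq_zero {p : ℂ[X]} (hp : p.degree < N) (h : coeffVec N p = 0) :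
    p = 0 := by
  ext n
  obtain hn | hn := lt_or_ge n N
  · rw [← coeffVec_apply p ⟨n, hn⟩, h, PiLp.zero_apply, coeff_zero]
  · exact coeff_eq_zero_of_degree_lt (hp.trans_le (by exact_mod_cast hn))

theorem degree_mul_lt_of_natDegree_add_le {R : Type*} [Semiring R] {P g : R[X]} {M : ℕ}
    (hP : P.natDegree + M ≤ N) (hg : g.degree < M) : (P * g).degree < N :=
  calc (P * g).degree ≤ P.natDegree + g.degree := degree_mul_le_of_le degree_le_natDegree le_rfl
    _ < P.natDegree + M := WithBot.add_lt_add_left WithBot.coe_ne_bot hg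
    _ ≤ N := by exact_mod_cast hP

theorem finrank_map_coeffVec_mulLeft {P : ℂ[X]} (hP₀ : P ≠ 0) {M : ℕ}
    (hP : P.natDegree + M ≤ N) :
    finrank ℂ ((degreeLT ℂ M).map (coeffVec N ∘ₗ LinearMap.mulLeft ℂ P)) = M := by
  have hinj : Function.Injective
      ((coeffVec N ∘ₗ LinearMap.mulLeft ℂ P).domRestrict (degreeLT ℂ M)) := by
    rw [injective_iff_map_eq_zero]
    rintro ⟨g, hg⟩ h
    have hPg : P * g = 0 := eq_zero_of_coeffVec_eq_zero
      (degree_mul_lt_of_natDegree_add_le hP (mem_degreeLT.1 hg)) h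
    exact Subtype.ext ((mul_eq_zero.1 hPg).resolve_left hP₀)
  rw [← LinearMap.range_domRestrict, LinearMap.finrank_range_of_inj hinj,
    (degreeLTEquiv ℂ M).finrank_eq, finrank_fin_fun]

end CoefficientVectors

section EdgePolynomials

theorem prod_abs_sub_two_pow_mul_le {u w : ℝ} {J : ℕ} (hw : 0 < w) (hwu : w ≤ u)
    (hu : u < 2 ^ J * w) :
    ∏ j ∈ range J, |u - 2 ^ j * w| ≤ 1 / 3 * ∏ j ∈ range J, |u + 2 ^ j * w| := by
  have habs_le (j : ℕ) : |u - 2 ^ j * w| ≤ |u + 2 ^ j * w| := by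
    have : 0 ≤ 2 ^ j * w := by positivity
    rw [abs_of_nonneg (a := u + 2 ^ j * w) (by linarith)]
    exact abs_le.2 ⟨by linarith, by linarith⟩
  obtain ⟨i, hiu, hui⟩ := exists_nat_pow_near ((one_le_div hw).2 hwu) (one_lt_two (α := ℝ))
  rw [le_div_iff₀ hw] at hiu
  rw [div_lt_iff₀ hw, pow_succ] at hui
  have hiJ : i ∈ range J := by
    have : (2 : ℝ) ^ i < 2 ^ J := lt_of_mul_lt_mul_right (hiu.trans_lt hu) hw.le
    exact mem_range.2 ((pow_lt_pow_iff_right₀ one_lt_two).1 this)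
  have hgain : |u - 2 ^ i * w| ≤ 1 / 3 * |u + 2 ^ i * w| := by
    have : 0 < 2 ^ i * w := by positivity
    rw [abs_of_nonneg (sub_nonneg.2 hiu), abs_of_nonneg (by linarith)]
    linarith
  rw [← mul_prod_erase _ _ hiJ, ← mul_prod_erase _ (fun j => |u + 2 ^ j * w|) hiJ, ← mul_assoc]
  exact mul_le_mul hgain (prod_le_prod (fun _ _ => abs_nonneg _) fun j _ => habs_le j)
    (by positivity) (by positivity)

theorem le_sin_pi_mul {x g : ℝ} (hg : 0 ≤ g) (hgx : g ≤ x) (hx : x ≤ 1 - g) :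
    g ≤ Real.sin (Real.pi * x) := by
  wlog h : x ≤ 1 / 2 generalizing x
  · have hsin := this (x := 1 - x) (by linarith) (by linarith) (by linarith)
    rwa [mul_one_sub, Real.sin_pi_sub] at hsin
  · have hpi := Real.pi_pos
    calc g ≤ 2 / Real.pi * (Real.pi * x) := by field_simp; linarith
      _ ≤ Real.sin (Real.pi * x) := Real.mul_le_sin (by nlinarith) (by nlinarith)

theorem fourierChar_sub_fourierChar_neg (a : ℝ) :
    (𝐞 a : ℂ) - 𝐞 (-a) = 2 * Complex.I * Real.sin (2 * Real.pi * a) := by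
  rw [Real.fourierChar_apply, Real.fourierChar_apply, Complex.ofReal_sin, Complex.sin]
  ring_nf
  simp only [Complex.I_sq]
  push_cast
  ring_nf

/-- The linear polynomial whose value at `exp (-2πif)` is `sin (π(f - V))` up to the factor
`2i * exp (-πif)`. -/
noncomputable def sinFactor (V : ℝ) : ℂ[X] := C (𝐞 (-(V / 2)) : ℂ) - C (𝐞 (V / 2) : ℂ) * X

/-- The linear polynomial whose value at `exp (-2πif)` has modulus
`2 * |sin (π(f - V)) + t * sin (π(f + V))|`. For `0 < V < 1/2` and `t > 0` its zero lies in the band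
`(-V, V)`, and changing the sign of `t` moves the zero out of the band. -/
noncomputable def edgeFactor (V t : ℝ) : ℂ[X] := sinFactor V + C (t : ℂ) * sinFactor (-V)

/-- The `m`-th power of the product of the edge factors with dyadic parameters `t * 2 ^ j`. -/
noncomputable def edgeProd (V t : ℝ) (J m : ℕ) : ℂ[X] :=
  (∏ j ∈ range J, edgeFactor V (t * 2 ^ j)) ^ m

theorem eval_sinFactor (V f : ℝ) :
    (sinFactor V).eval (𝐞 (-f) : ℂ) =
      𝐞 (-(f / 2)) * (2 * Complex.I) * Real.sin (Real.pi * (f - V)) := by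
  have hsin := fourierChar_sub_fourierChar_neg ((f - V) / 2)
  rw [show 2 * Real.pi * ((f - V) / 2) = Real.pi * (f - V) by ring] at hsin
  rw [mul_assoc, ← hsin]
  simp only [sinFactor, eval_sub, eval_mul, eval_C, eval_X, mul_sub, ← Circle.coe_mul,
    ← AddChar.map_add_eq_mul]
  ring_nf

theorem norm_eval_edgeFactor (V t f : ℝ) :
    ‖(edgeFactor V t).eval (𝐞 (-f) : ℂ)‖ =
      2 * |Real.sin (Real.pi * (f - V)) + t * Real.sin (Real.pi * (f + V))| := by
  have heval : (edgeFactor V t).eval (𝐞 (-f) : ℂ) = 𝐞 (-(f / 2)) * (2 * Complex.I) *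
      (Real.sin (Real.pi * (f - V)) + t * Real.sin (Real.pi * (f + V)) : ℝ) := by
    rw [edgeFactor, eval_add, eval_mul, eval_C, eval_sinFactor, eval_sinFactor, sub_neg_eq_add]
    push_cast
    ring
  rw [heval, norm_mul, norm_mul, Circle.norm_coe, Complex.norm_real, Real.norm_eq_abs]
  simp

theorem norm_eval_edgeProd (V t f : ℝ) (J m : ℕ) :
    ‖(edgeProd V t J m).eval (𝐞 (-f) : ℂ)‖ =
      (2 ^ J * ∏ j ∈ range J, |Real.sin (Real.pi * (f - V)) +
        t * 2 ^ j * Real.sin (Real.pi * (f + V))|) ^ m := by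
  rw [edgeProd, eval_pow, norm_pow, eval_prod, norm_prod]
  simp only [norm_eval_edgeFactor, prod_mul_distrib, prod_const, card_range]

theorem natDegree_edgeFactor_le (V t : ℝ) : (edgeFactor V t).natDegree ≤ 1 := by
  unfold edgeFactor sinFactor
  compute_degree

theorem natDegree_edgeProd_le (V t : ℝ) (J m : ℕ) : (edgeProd V t J m).natDegree ≤ m * J :=
  natDegree_pow_le_of_le m <|
    calc (∏ j ∈ range J, edgeFactor V (t * 2 ^ j)).natDegree
        ≤ ∑ j ∈ range J, (edgeFactor V (t * 2 ^ j)).natDegree := natDegree_prod_le _ _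
      _ ≤ ∑ _j ∈ range J, 1 := by gcongr; exact natDegree_edgeFactor_le V _
      _ = J := by simp

theorem edgeFactor_ne_zero {V t : ℝ} (hV₀ : 0 < V) (hV : V < 1 / 2) (ht : t ≠ 0) :
    edgeFactor V t ≠ 0 := by
  intro hzero
  have hpi := Real.pi_pos
  have hsin : 0 < Real.sin (Real.pi * (V + V)) :=
    Real.sin_pos_of_pos_of_lt_pi (by positivity) (by nlinarith)
  have hnorm := norm_eval_edgeFactor V t V
  simp [hzero, ht, hsin.ne'] at hnorm

theorem edgeProd_ne_zero {V t : ℝ} (hV₀ : 0 < V) (hV : V < 1 / 2) (ht : t ≠ 0) (J m : ℕ) :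
    edgeProd V t J m ≠ 0 :=
  pow_ne_zero _ (prod_ne_zero_iff.2 fun _ _ => edgeFactor_ne_zero hV₀ hV (by positivity))

theorem norm_eval_edgeProd_neg_le {V t f : ℝ} (hV : 0 ≤ V) (ht : 0 ≤ t)
    (hf : f ∈ Set.Icc V (1 - V)) (J m : ℕ) :
    ‖(edgeProd V (-t) J m).eval (𝐞 (-f) : ℂ)‖ ≤ ‖(edgeProd V t J m).eval (𝐞 (-f) : ℂ)‖ := by
  have hpi := Real.pi_pos
  have hsub : 0 ≤ Real.sin (Real.pi * (f - V)) :=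
    Real.sin_nonneg_of_nonneg_of_le_pi (by nlinarith [hf.1]) (by nlinarith [hf.2])
  have hadd : 0 ≤ Real.sin (Real.pi * (f + V)) :=
    Real.sin_nonneg_of_nonneg_of_le_pi (by nlinarith [hf.1]) (by nlinarith [hf.2])
  rw [norm_eval_edgeProd, norm_eval_edgeProd]
  gcongr ((2 ^ J * ∏ j ∈ _, ?_) ^ m) with j
  have : 0 ≤ t * 2 ^ j * Real.sin (Real.pi * (f + V)) := by positivity
  rw [abs_of_nonneg (add_nonneg hsub this)]
  exact abs_le.2 ⟨by linarith, by linarith⟩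

theorem norm_eval_edgeProd_le {W δ f : ℝ} {J : ℕ} (hδ : 0 < δ) (hJ : 1 < 2 ^ J * δ ^ 2)
    (hV : W + δ ≤ 1 / 2) (hf : f ∈ Set.Icc (-W) W) (m : ℕ) :
    ‖(edgeProd (W + δ) δ J m).eval (𝐞 (-f) : ℂ)‖ ≤
      (1 / 3) ^ m * ‖(edgeProd (W + δ) (-δ) J m).eval (𝐞 (-f) : ℂ)‖ := by
  obtain ⟨hWf, hfW⟩ := hf
  have hu := le_sin_pi_mul (x := W + δ - f) hδ.le (by linarith) (by linarith)
  have hv := le_sin_pi_mul (x := f + (W + δ)) hδ.le (by linarith) (by linarith)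
  have hu₁ := Real.sin_le_one (Real.pi * (W + δ - f))
  have hv₁ := Real.sin_le_one (Real.pi * (f + (W + δ)))
  have hneg : Real.sin (Real.pi * (f - (W + δ))) = -Real.sin (Real.pi * (W + δ - f)) := by
    rw [← Real.sin_neg]; ring_nf
  rw [norm_eval_edgeProd, norm_eval_edgeProd, hneg, ← mul_pow]
  set u := Real.sin (Real.pi * (W + δ - f))
  set v := Real.sin (Real.pi * (f + (W + δ)))
  have hprod : ∏ j ∈ range J, |u - 2 ^ j * (δ * v)| ≤
      1 / 3 * ∏ j ∈ range J, |u + 2 ^ j * (δ * v)| :=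
    prod_abs_sub_two_pow_mul_le (mul_pos hδ (hδ.trans_le hv)) (by nlinarith) <|
      calc u ≤ 1 := hu₁
        _ < 2 ^ J * δ ^ 2 := hJ
        _ ≤ 2 ^ J * (δ * v) := by rw [sq]; gcongr
  have hsub (j : ℕ) : |-u + δ * 2 ^ j * v| = |u - 2 ^ j * (δ * v)| := by
    rw [← abs_neg]; ring_nf
  have hadd (j : ℕ) : |-u + -δ * 2 ^ j * v| = |u + 2 ^ j * (δ * v)| := by
    rw [← abs_neg]; ring_nf
  simp only [hsub, hadd]
  rw [mul_left_comm (1 / 3)]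
  gcongr

end EdgePolynomials

section BandNodes

variable {N : ℕ}

open Classical in
/-- The indices `k` of the grid points `k / N` that lie, modulo `1`, in the band `(-V, V)`. -/
noncomputable def bandNodes (N : ℕ) (V : ℝ) : Finset ℕ :=
  {k ∈ range N | (k / N : ℝ) ∉ Set.Icc V (1 - V)}

/-- The monic polynomial that vanishes exactly at the points `exp (-2πik/N)` for `k` in
`bandNodes N V`. -/
noncomputable def bandNodePoly (N : ℕ) (V : ℝ) : ℂ[X] :=
  ∏ k ∈ bandNodes N V, (X - C (𝐞 (-(k / N)) : ℂ))

theorem monic_bandNodePoly (N : ℕ) (V : ℝ) : (bandNodePoly N V).Monic :=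
  monic_prod_of_monic _ _ fun _ _ => monic_X_sub_C _

theorem natDegree_bandNodePoly (N : ℕ) (V : ℝ) :
    (bandNodePoly N V).natDegree = #(bandNodes N V) :=
  natDegree_finsetProd_X_sub_C_eq_card _ _

theorem eval_bandNodePoly {V : ℝ} {k : ℕ} (hk : k ∈ bandNodes N V) :
    (bandNodePoly N V).eval (𝐞 (-(k / N)) : ℂ) = 0 := by
  rw [bandNodePoly, eval_prod]
  exact prod_eq_zero hk (by simp)

theorem card_bandNodes_le (N : ℕ) (V : ℝ) : #(bandNodes N V) ≤ 2 * ⌈N * V⌉₊ := by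
  classical
  have hsub : bandNodes N V ⊆ range ⌈N * V⌉₊ ∪ Ico (N - ⌈N * V⌉₊) N := by
    intro k hk
    obtain ⟨hkN, hk⟩ := mem_filter.1 hk
    have hkN := mem_range.1 hkN
    have hN : (0 : ℝ) < N := by exact_mod_cast (Nat.zero_le k).trans_lt hkN
    rw [Set.mem_Icc, not_and_or, not_le, not_le, div_lt_iff₀ hN, lt_div_iff₀ hN] at hk
    simp only [mem_union, mem_range, mem_Ico, Nat.lt_ceil]
    refine hk.imp (fun h => by linarith) fun h => ⟨?_, hkN⟩
    have : (N : ℝ) ≤ (⌈N * V⌉₊ + k : ℕ) := by push_cast; linarith [Nat.le_ceil (N * V)]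
    rw [Nat.cast_le] at this
    omega
  calc #(bandNodes N V) ≤ #(range ⌈N * V⌉₊) + #(Ico (N - ⌈N * V⌉₊) N) :=
        (card_le_card hsub).trans (card_union_le _ _)
    _ ≤ 2 * ⌈N * V⌉₊ := by rw [card_range, Nat.card_Ico]; omega

end BandNodes

section EigenvalueBound

variable {N J m : ℕ} {W : ℝ}

theorem re_inner_toEuclideanLin_prolateMatrix (W : ℝ) (x : EuclideanSpace ℂ (Fin N)) :
    RCLike.re (inner ℂ x ((prolateMatrix N W).toEuclideanLin x)) = bandEnergy W x := by
  rw [← ofReal_bandEnergy]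
  exact Complex.ofReal_re _

theorem isDPSS_iff_toEuclideanLin {s : Fin N → EuclideanSpace ℂ (Fin N)} :
    IsDPSS N W s ↔ Orthonormal ℂ s ∧ ∃ ν : Fin N → ℝ, Antitone ν ∧
      ∀ l, (prolateMatrix N W).toEuclideanLin (s l) = (ν l : ℂ) • s l := by
  simp only [IsDPSS, ← (WithLp.ofLp_injective 2).eq_iff, Matrix.ofLp_toLpLin,
    Matrix.toLin'_apply, WithLp.ofLp_smul]

theorem natDegree_edgeProd_mul_bandNodePoly_le (N J m : ℕ) (V t : ℝ) :
    (edgeProd V t J m * bandNodePoly N V).natDegree ≤ m * J + #(bandNodes N V) :=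
  natDegree_mul_le_of_le (natDegree_edgeProd_le V t J m) (natDegree_bandNodePoly N V).le

theorem norm_coeffVec_edgeProd_neg_le [NeZero N] {V t : ℝ} {M : ℕ} {g : ℂ[X]} (hV : 0 ≤ V)
    (ht : 0 ≤ t) (hM : m * J + #(bandNodes N V) + M ≤ N) (hg : g.degree < M) :
    ‖coeffVec N (edgeProd V (-t) J m * bandNodePoly N V * g)‖ ≤
      ‖coeffVec N (edgeProd V t J m * bandNodePoly N V * g)‖ := by
  have hdeg (t : ℝ) : (edgeProd V t J m * bandNodePoly N V).natDegree + M ≤ N :=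
    (Nat.add_le_add_right (natDegree_edgeProd_mul_bandNodePoly_le N J m V t) M).trans hM
  refine norm_coeffVec_le_of_norm_eval_le (degree_mul_lt_of_natDegree_add_le (hdeg t) hg)
    (degree_mul_lt_of_natDegree_add_le (hdeg (-t)) hg) fun k hk => ?_
  simp only [eval_mul, norm_mul]
  by_cases hkV : k ∈ bandNodes N V
  · simp [eval_bandNodePoly hkV]
  · have hkf : (k / N : ℝ) ∈ Set.Icc V (1 - V) := by
      simpa [bandNodes, mem_range.1 hk] using hkV
    gcongr
    exact norm_eval_edgeProd_neg_le hV ht hkf J m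

theorem bandEnergy_coeffVec_edgeProd_le [NeZero N] {δ : ℝ} {M : ℕ} {g : ℂ[X]} (hW : 0 ≤ W)
    (hδ : 0 < δ) (hV : W + δ ≤ 1 / 2) (hJ : 1 < 2 ^ J * δ ^ 2)
    (hM : m * J + #(bandNodes N (W + δ)) + M ≤ N) (hg : g.degree < M) :
    bandEnergy W (coeffVec N (edgeProd (W + δ) δ J m * bandNodePoly N (W + δ) * g)) ≤
      (1 / 9) ^ m * min 1 (2 * N * W) *
        ‖coeffVec N (edgeProd (W + δ) δ J m * bandNodePoly N (W + δ) * g)‖ ^ 2 := by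
  set p := edgeProd (W + δ) δ J m * bandNodePoly N (W + δ) * g
  set q := edgeProd (W + δ) (-δ) J m * bandNodePoly N (W + δ) * g
  have hdeg (t : ℝ) : (edgeProd (W + δ) t J m * bandNodePoly N (W + δ) * g).degree < N :=
    degree_mul_lt_of_natDegree_add_le
      ((Nat.add_le_add_right (natDegree_edgeProd_mul_bandNodePoly_le N J m _ t) M).trans hM) hg
  have hin : bandEnergy W (coeffVec N p) ≤ ((1 / 3) ^ m) ^ 2 * bandEnergy W (coeffVec N q) := by
    refine bandEnergy_coeffVec_le_of_norm_eval_le (hdeg δ) (hdeg (-δ)) hW fun f hf => ?_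
    simp only [eval_mul, norm_mul, ← mul_assoc]
    gcongr
    exact norm_eval_edgeProd_le hδ hJ hV hf m
  have : 0 ≤ min 1 (2 * N * W) := le_min zero_le_one (by positivity)
  calc bandEnergy W (coeffVec N p)
      ≤ ((1 / 3) ^ m) ^ 2 * bandEnergy W (coeffVec N q) := hin
    _ ≤ ((1 / 3) ^ m) ^ 2 * (min 1 (2 * N * W) * ‖coeffVec N q‖ ^ 2) := by
        gcongr; exact bandEnergy_le_min hW (by linarith) _
    _ ≤ ((1 / 3) ^ m) ^ 2 * (min 1 (2 * N * W) * ‖coeffVec N p‖ ^ 2) := by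
        gcongr; exact norm_coeffVec_edgeProd_neg_le (by positivity) hδ.le hM hg
    _ = (1 / 9) ^ m * min 1 (2 * N * W) * ‖coeffVec N p‖ ^ 2 := by
        rw [pow_right_comm, ← mul_assoc]; norm_num

theorem eigenvalue_prolateMatrix_le_of_card_bandNodes_le {δ : ℝ} (hW : 0 ≤ W) (hδ : 0 < δ)
    (hV : W + δ < 1 / 2) (hJ : 1 < 2 ^ J * δ ^ 2) {s : Fin N → EuclideanSpace ℂ (Fin N)}
    (hs : Orthonormal ℂ s) {ν : Fin N → ℝ} (hν : Antitone ν)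
    (hsν : ∀ l, (prolateMatrix N W).toEuclideanLin (s l) = (ν l : ℂ) • s l) {l : Fin N}
    (hl : m * J + #(bandNodes N (W + δ)) ≤ l) : ν l ≤ (1 / 9) ^ m * min 1 (2 * N * W) := by
  have : NeZero N := l.neZero
  obtain ⟨M, hM⟩ := Nat.exists_eq_add_of_le (hl.trans l.2.le)
  set P := edgeProd (W + δ) δ J m * bandNodePoly N (W + δ)
  have hP₀ : P ≠ 0 := mul_ne_zero (edgeProd_ne_zero (by positivity) hV hδ.ne' J m)
    (monic_bandNodePoly N _).ne_zero
  have hdeg : P.natDegree + M ≤ N :=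
    (Nat.add_le_add_right (natDegree_edgeProd_mul_bandNodePoly_le N J m _ _) M).trans hM.ge
  refine eigenvalue_le_of_finrank_le hs hν hsν
    (U := (degreeLT ℂ M).map (coeffVec N ∘ₗ LinearMap.mulLeft ℂ P)) ?_ ?_
  · rintro _ ⟨g, hg, rfl⟩
    rw [re_inner_toEuclideanLin_prolateMatrix]
    exact bandEnergy_coeffVec_edgeProd_le hW hδ hV.le hJ hM.ge (mem_degreeLT.1 hg)
  · rw [finrank_map_coeffVec_mulLeft hP₀ hdeg, finrank_euclideanSpace_fin]
    omega

theorem eigenvalue_prolateMatrix_le (hW : 0 ≤ W) (hJ : N ^ 2 < 2 ^ J)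
    {s : Fin N → EuclideanSpace ℂ (Fin N)} (hs : Orthonormal ℂ s) {ν : Fin N → ℝ}
    (hν : Antitone ν) (hsν : ∀ l, (prolateMatrix N W).toEuclideanLin (s l) = (ν l : ℂ) • s l)
    {l : Fin N} (hl : m * J + 2 * ⌈N * W + 1⌉₊ ≤ l) : ν l ≤ (1 / 9) ^ m * min 1 (2 * N * W) := by
  have hN : (0 : ℝ) < N := Nat.cast_pos.2 l.pos
  have hNV : N * (W + 1 / N) = N * W + 1 := by field_simp
  have hV : W + 1 / N < 1 / 2 := by
    have hceil : 2 * ⌈N * W + 1⌉₊ < N := by omega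
    have : 2 * (⌈N * W + 1⌉₊ : ℝ) < N := by exact_mod_cast hceil
    refine lt_of_mul_lt_mul_left ?_ hN.le
    linarith [Nat.le_ceil (N * W + 1)]
  have hJ' : (1 : ℝ) < 2 ^ J * (1 / N) ^ 2 := by
    rw [one_div_pow, mul_one_div, one_lt_div (by positivity)]
    exact_mod_cast hJ
  refine eigenvalue_prolateMatrix_le_of_card_bandNodes_le hW (by positivity) hV hJ' hs hν hsν
    (le_trans ?_ hl)
  have hcard := card_bandNodes_le N (W + 1 / N)
  rw [hNV] at hcard
  omega

end EigenvalueBound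

section Residual

variable {N K : ℕ} {W ε : ℝ}

theorem mul_le_integral_of_forall_near_le {g : ℝ → ℝ} {a b f₀ h r : ℝ}
    (hg : IntervalIntegrable g MeasureTheory.volume a b) (hg₀ : ∀ f, 0 ≤ g f)
    (hf₀ : f₀ ∈ Set.Icc a b) (hh : 0 ≤ h) (hab : 2 * h ≤ b - a)
    (hr : ∀ f, |f - f₀| ≤ h → r ≤ g f) : h * r ≤ ∫ f in a..b, g f := by
  obtain ⟨c, hac, hcb, hc⟩ : ∃ c, a ≤ c ∧ c + h ≤ b ∧ ∀ f ∈ Set.Icc c (c + h), |f - f₀| ≤ h := by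
    rcases le_total (f₀ + h) b with hright | hright
    · exact ⟨f₀, hf₀.1, hright, fun f hf => abs_le.2 ⟨by linarith [hf.1], by linarith [hf.2]⟩⟩
    · exact ⟨f₀ - h, by linarith, by linarith [hf₀.2],
        fun f hf => abs_le.2 ⟨by linarith [hf.1], by linarith [hf.2]⟩⟩
  calc h * r = ∫ _ in c..(c + h), r := by simp
    _ ≤ ∫ f in c..(c + h), g f :=
        intervalIntegral.integral_mono_on (by linarith) intervalIntegrable_const
          (hg.mono_set (Set.uIcc_subset_uIcc (by grind [Set.mem_uIcc]) (by grind [Set.mem_uIcc])))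
          fun f hf => hr f (hc f hf)
    _ ≤ ∫ f in a..b, g f := intervalIntegral.integral_mono_interval hac (by linarith) hcb
          (.of_forall hg₀) hg

theorem half_norm_sq_le_norm_dtft {x : EuclideanSpace ℂ (Fin N)} {f₀ f : ℝ} (hε : 0 ≤ ε)
    (hε₁ : ε ≤ 1) (hx : ‖dtft x f₀‖ = ‖x‖ ^ 2) (hεx : ε * N ≤ ‖x‖ ^ 2)
    (hf : |f - f₀| * (4 * Real.pi * N) ≤ ε) : ‖x‖ ^ 2 / 2 ≤ ‖dtft x f‖ := by
  have hsqrt : ε * √N ≤ ‖x‖ := by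
    refine le_of_sq_le_sq ?_ (norm_nonneg x)
    calc (ε * √N) ^ 2 = ε * (ε * N) := by rw [mul_pow, Real.sq_sqrt N.cast_nonneg]; ring
      _ ≤ 1 * ‖x‖ ^ 2 := by gcongr
      _ = ‖x‖ ^ 2 := one_mul _
  have hdiff : ‖dtft x f₀ - dtft x f‖ ≤ ‖x‖ ^ 2 / 2 := by
    calc ‖dtft x f₀ - dtft x f‖ ≤ √N * (2 * Real.pi * N * |f₀ - f|) * ‖x‖ :=
          norm_dtft_sub_le x f₀ f
      _ = |f - f₀| * (4 * Real.pi * N) * √N * ‖x‖ / 2 := by rw [abs_sub_comm]; ring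
      _ ≤ ε * √N * ‖x‖ / 2 := by gcongr
      _ ≤ ‖x‖ * ‖x‖ / 2 := by gcongr
      _ = ‖x‖ ^ 2 / 2 := by rw [sq]
  linarith [norm_sub_norm_le (dtft x f₀) (dtft x f)]

theorem sq_div_sixteen_mul_min_le {n : ℝ} (hW : 0 ≤ W) (hε : 0 < ε) (hε₁ : ε ≤ 1) (hn : 0 < n) :
    ε ^ 2 / 16 * min 1 (2 * n * W) ≤ min W (ε / (4 * Real.pi * n)) * (ε * n) := by
  rw [min_mul_of_nonneg _ _ (by positivity : 0 ≤ ε * n)]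
  refine le_min ?_ ?_
  · calc ε ^ 2 / 16 * min 1 (2 * n * W) ≤ ε ^ 2 / 16 * (2 * n * W) := by
          gcongr; exact min_le_right _ _
      _ = ε / 8 * (W * (ε * n)) := by ring
      _ ≤ W * (ε * n) := mul_le_of_le_one_left (by positivity) (by linarith)
  · calc ε ^ 2 / 16 * min 1 (2 * n * W) ≤ ε ^ 2 / 16 :=
          mul_le_of_le_one_right (by positivity) (min_le_left _ _)
      _ ≤ ε ^ 2 / (4 * Real.pi) := by gcongr; linarith [Real.pi_le_four]
      _ = ε / (4 * Real.pi * n) * (ε * n) := by field_simp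

theorem norm_sq_le_of_bandEnergy_le [NeZero N] {x : EuclideanSpace ℂ (Fin N)} {f₀ : ℝ}
    (hW : 0 < W) (hε : 0 < ε) (hε₁ : ε ≤ 1) (hf₀ : f₀ ∈ Set.Icc (-W) W)
    (hx : ‖dtft x f₀‖ = ‖x‖ ^ 2)
    (hband : bandEnergy W x ≤ ε ^ 2 / 64 * min 1 (2 * N * W) * ‖x‖ ^ 2) :
    ‖x‖ ^ 2 ≤ ε * N := by
  by_contra! hεx
  have hN : (0 : ℝ) < N := Nat.cast_pos.2 (NeZero.pos N)
  set h := min W (ε / (4 * Real.pi * N))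
  have hh₀ : 0 < h := lt_min hW (by positivity)
  have hhW : h ≤ W := min_le_left _ _
  have hhε : h * (4 * Real.pi * N) ≤ ε := (le_div_iff₀ (by positivity)).1 (min_le_right _ _)
  have hconc : h * (‖x‖ ^ 2 / 2) ^ 2 ≤ bandEnergy W x := by
    refine mul_le_integral_of_forall_near_le (intervalIntegrable_norm_sq_dtft x _ _)
      (fun f => by positivity) hf₀ hh₀.le (by linarith) fun f hf => ?_
    gcongr
    exact half_norm_sq_le_norm_dtft hε.le hε₁ hx hεx.le
      (le_trans (by gcongr) hhε)
  have hhx : h * ‖x‖ ^ 2 ≤ ε ^ 2 / 16 * min 1 (2 * N * W) := by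
    have hx₀ : 0 < ‖x‖ ^ 2 := lt_trans (by positivity) hεx
    refine le_of_mul_le_mul_right ?_ hx₀
    linarith
  have hhN := sq_div_sixteen_mul_min_le hW.le hε hε₁ hN
  have hlt : h * (ε * N) < h * ‖x‖ ^ 2 := by gcongr
  linarith

theorem toLp_firstColumns_mul_conjTranspose_mulVec (hK : K ≤ N)
    (s : Fin N → EuclideanSpace ℂ (Fin N)) (e : EuclideanSpace ℂ (Fin N)) :
    (WithLp.toLp 2 ((firstColumns hK s * (firstColumns hK s)ᴴ) *ᵥ e.ofLp) :
        EuclideanSpace ℂ (Fin N)) =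
      ∑ k : Fin K, inner ℂ (s (k.castLE hK)) e • s (k.castLE hK) := by
  ext n
  rw [← Matrix.mulVec_mulVec]
  simp [Matrix.mulVec, dotProduct, firstColumns, PiLp.inner_apply, mul_comm]

theorem sum_eq_sum_castLE_add_sum_le {M : Type*} [AddCommMonoid M] (hK : K ≤ N) (g : Fin N → M) :
    ∑ l, g l = ∑ k : Fin K, g (k.castLE hK) + ∑ l : Fin N with K ≤ l.val, g l := by
  have hmap : ({l | ¬ K ≤ l.val} : Finset (Fin N)) = univ.map (Fin.castLEEmb hK) := by
    ext l
    simp only [mem_filter, mem_univ, true_and, not_le, mem_map, Fin.castLEEmb_apply]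
    exact ⟨fun h => ⟨⟨l, h⟩, rfl⟩, by rintro ⟨k, rfl⟩; exact k.2⟩
  rw [← sum_filter_not_add_sum_filter univ (fun l : Fin N => K ≤ l.val), hmap, sum_map]
  rfl

theorem toLp_sub_firstColumns_mul_conjTranspose_mulVec (hK : K ≤ N)
    {s : Fin N → EuclideanSpace ℂ (Fin N)} (hs : Orthonormal ℂ s)
    (e : EuclideanSpace ℂ (Fin N)) :
    (WithLp.toLp 2 (e.ofLp - (firstColumns hK s * (firstColumns hK s)ᴴ) *ᵥ e.ofLp) :
        EuclideanSpace ℂ (Fin N)) =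
      ∑ l : Fin N with K ≤ l.val, inner ℂ (s l) e • s l := by
  have hspan : Submodule.span ℂ (Set.range s) = ⊤ :=
    hs.linearIndependent.span_eq_top_of_card_eq_finrank' (by simp)
  have hexpand : ∑ l, inner ℂ (s l) e • s l = e := by
    simpa using (OrthonormalBasis.mk hs hspan.ge).sum_repr' e
  rw [WithLp.toLp_sub, toLp_firstColumns_mul_conjTranspose_mulVec, WithLp.toLp_ofLp,
    sub_eq_iff_eq_add', ← sum_eq_sum_castLE_add_sum_le hK fun l => inner ℂ (s l) e • s l, hexpand]

theorem l2norm_sampledExp_sub_firstColumns_sq_le [NeZero N] {J m : ℕ} {f : ℝ} (hW : 0 < W)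
    (hε : 0 < ε) (hε₁ : ε ≤ 1) (hJ : N ^ 2 < 2 ^ J) (hm : (1 / 9) ^ m ≤ ε ^ 2 / 64) (hK : K ≤ N)
    (hJmK : min N (m * J + 2 * ⌈N * W + 1⌉₊) ≤ K) {s : Fin N → EuclideanSpace ℂ (Fin N)}
    (hs : IsDPSS N W s) (hf : f ∈ Set.Icc (-W) W) :
    l2norm (sampledExp N f -
      (firstColumns hK s * (firstColumns hK s)ᴴ) *ᵥ sampledExp N f) ^ 2 ≤ ε * N := by
  obtain ⟨hs, ν, hν, hsν⟩ := isDPSS_iff_toEuclideanLin.1 hs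
  have htail := toLp_sub_firstColumns_mul_conjTranspose_mulVec hK hs (expVec N f)
  rw [expVec] at htail
  rw [l2norm, htail, ← expVec]
  refine norm_sq_le_of_bandEnergy_le hW hε hε₁ hf ?_ ?_
  · rw [dtft, inner_sum_inner_smul_of_orthonormal hs]
    exact Complex.norm_of_nonneg (by positivity)
  · rw [← re_inner_toEuclideanLin_prolateMatrix]
    refine re_inner_map_sum_smul_le_of_eigenvalue_le hs hsν _ fun l hl => ?_
    have hKl : K ≤ l := (mem_filter.1 hl).2
    have : 0 ≤ min 1 (2 * N * W) := le_min zero_le_one (by positivity)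
    calc ν l ≤ (1 / 9) ^ m * min 1 (2 * N * W) :=
          eigenvalue_prolateMatrix_le hW.le hJ hs hν hsν (by have := l.2; omega)
      _ ≤ ε ^ 2 / 64 * min 1 (2 * N * W) := by gcongr

end Residual

theorem exists_sq_lt_two_pow_le_log {N : ℕ} (hN : 2 ≤ N) :
    ∃ J : ℕ, N ^ 2 < 2 ^ J ∧ (J : ℝ) ≤ 6 * Real.log N := by
  refine ⟨2 * (Nat.log 2 N + 1), ?_, ?_⟩
  · rw [mul_comm 2, pow_mul]
    exact Nat.pow_lt_pow_left (Nat.lt_pow_succ_log_self one_lt_two N) two_ne_zero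
  · have hlog₂ : Real.log 2 ≤ Real.log N := Real.log_le_log two_pos (by exact_mod_cast hN)
    have hlogN : Nat.log 2 N * Real.log 2 ≤ Real.log N := by
      rw [← Real.log_pow]
      exact Real.log_le_log (by positivity) (by exact_mod_cast Nat.pow_log_le_self 2 (by omega))
    have := Real.log_two_gt_d9
    push_cast
    nlinarith [(Nat.log 2 N).cast_nonneg (α := ℝ)]

theorem two_mul_log_two_le_log_one_div_sq {ε : ℝ} (hε : 0 < ε) (hε₂ : ε ≤ 1 / 2) :
    2 * Real.log 2 ≤ Real.log (1 / ε ^ 2) := by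
  have hlog := Real.log_le_log hε hε₂
  rw [one_div, Real.log_inv] at hlog ⊢
  rw [Real.log_pow]
  push_cast
  linarith

theorem exists_one_ninth_pow_le_and_le_log {ε : ℝ} (hε : 0 < ε) (hε₂ : ε ≤ 1 / 2) :
    ∃ m : ℕ, (1 / 9) ^ m ≤ ε ^ 2 / 64 ∧ (m : ℝ) ≤ 5 * Real.log (1 / ε ^ 2) := by
  have hL := two_mul_log_two_le_log_one_div_sq hε hε₂
  have hlog₂ := Real.log_two_gt_d9
  set L := Real.log (1 / ε ^ 2) with hLdef
  refine ⟨⌈4 * L⌉₊, ?_, by linarith [Nat.ceil_lt_add_one (show 0 ≤ 4 * L by linarith)]⟩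
  calc (1 / 9 : ℝ) ^ ⌈4 * L⌉₊ ≤ Real.exp (-1) ^ ⌈4 * L⌉₊ := by
        gcongr
        rw [Real.exp_neg, one_div]
        gcongr
        linarith [Real.exp_one_lt_d9]
    _ = Real.exp (-⌈4 * L⌉₊) := by rw [← Real.exp_nat_mul, mul_neg_one]
    _ ≤ Real.exp ((4 : ℕ) * -L) := by
        push_cast; gcongr; linarith [Nat.le_ceil (4 * L)]
    _ = (ε ^ 2) ^ 4 := by
        rw [Real.exp_nat_mul, hLdef, one_div, Real.log_inv, neg_neg, Real.exp_log (by positivity)]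
    _ = ε ^ 2 * ε ^ 6 := by ring
    _ ≤ ε ^ 2 * (1 / 2) ^ 6 := by gcongr
    _ = ε ^ 2 / 64 := by ring

theorem abs_min_sub_two_mul_le {W : ℝ} (hW₀ : 0 ≤ W) (hW : W ≤ 1 / 2) (N k : ℕ) :
    |(min N (k + 2 * ⌈N * W + 1⌉₊) : ℕ) - 2 * N * W| ≤ k + 4 := by
  have hceil_ge := Nat.le_ceil (N * W + 1)
  have hceil_lt := Nat.ceil_lt_add_one (show 0 ≤ N * W + 1 by positivity)
  have : (0 : ℝ) ≤ k := k.cast_nonneg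
  have hN : 2 * N * W ≤ N := by nlinarith [N.cast_nonneg (α := ℝ)]
  push_cast
  rw [abs_of_nonneg (sub_nonneg.2 (le_min hN (by linarith)))]
  linarith [min_le_right (N : ℝ) (k + 2 * ⌈N * W + 1⌉₊)]

theorem l2norm_sampledExp_sq (N : ℕ) (f : ℝ) : l2norm (sampledExp N f) ^ 2 = N :=
  norm_expVec_sq f

theorem mainTheorem6 :
    ∃ C : ℝ, 0 < C ∧
      ∀ (N : ℕ), 2 ≤ N →
      ∀ (W : ℝ), W ∈ Set.Ioo (0 : ℝ) (1 / 2) →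
      ∀ (ε : ℝ), ε ∈ Set.Ioo (0 : ℝ) (1 / 2) →
      ∃ (K : ℕ) (hK : K ≤ N),
        |(K : ℝ) - 2 * (N : ℝ) * W| ≤ C * (Real.log (N : ℝ) * Real.log (1 / ε ^ 2)) ∧
        ∀ (s : Fin N → EuclideanSpace ℂ (Fin N)), IsDPSS N W s →
        ∀ (f : ℝ), f ∈ Set.Icc (-W) W →
          l2norm (sampledExp N f -
              (firstColumns hK s * (firstColumns hK s)ᴴ) *ᵥ sampledExp N f) ^ 2 /
            l2norm (sampledExp N f) ^ 2 ≤ ε := by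
  refine ⟨40, by norm_num, fun N hN W ⟨hW₀, hW⟩ ε ⟨hε₀, hε⟩ => ?_⟩
  have : NeZero N := ⟨by omega⟩
  obtain ⟨J, hJ, hJ_le⟩ := exists_sq_lt_two_pow_le_log hN
  obtain ⟨m, hm, hm_le⟩ := exists_one_ninth_pow_le_and_le_log hε₀ hε.le
  refine ⟨min N (m * J + 2 * ⌈N * W + 1⌉₊), min_le_left _ _, ?_, fun s hs f hf => ?_⟩
  · have hlog₂ := Real.log_two_gt_d9
    have hlogN : Real.log 2 ≤ Real.log N := Real.log_le_log two_pos (by exact_mod_cast hN)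
    have hlogε := two_mul_log_two_le_log_one_div_sq hε₀ hε.le
    have hmJ : (m : ℝ) * J ≤ 5 * Real.log (1 / ε ^ 2) * (6 * Real.log N) :=
      mul_le_mul hm_le hJ_le J.cast_nonneg (by linarith)
    have hdim := abs_min_sub_two_mul_le hW₀.le hW.le N (m * J)
    push_cast at hdim ⊢
    nlinarith
  · rw [l2norm_sampledExp_sq, div_le_iff₀ (Nat.cast_pos.2 (NeZero.pos N))]
    exact l2norm_sampledExp_sub_firstColumns_sq_le hW₀ hε₀ (by linarith) hJ hm _ le_rfl hs hf
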